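/- Let $Q$ be a free abelian group of rank $2$, written multiplicatively and generated by $x,y$ (so $Q=\langle x,y\rangle\simeq\mathbb{Z}^2$). Let $J$ be an ideal of the integral group ring $\mathbb{Z}Q$ such that $R=\mathbb{Z}Q/J$ is an integral domain of characteristic zero and of Krull dimension $2$, and suppose that for every non-trivial element $q\in Q$ the image of $q$ in $R$, viewed in the field of fractions of $R$, is not algebraic over $\mathbb{Q}$. Let $n,c_1,c_2$ be positive integers, let $Q_1$ be the subgroup of $Q$ generated by $x^n,y^n$, let $Q_2$ be the subgroup of $Q$ generated by $x^{c_1},y^{c_2}$, and for $i=1,2$ let $R_i$ be the subring of $R$ generated by the image of $Q_i$. If there is a ring homomorphism $\varphi:R_1\to R_2$ that sends the image of $x^n$ to the image of $x^{c_1}$ and the image of $y^n$ to the image of $y^{c_2}$, then $n=c_1=c_2$. -/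

import Mathlib

/-- The canonical map from `Q` to the quotient `ℤQ / J` of the integral group ring. -/
noncomputable def groupToQuot {Q : Type*} [CommGroup Q] (J : Ideal (MonoidAlgebra ℤ Q)) :
    Q →* MonoidAlgebra ℤ Q ⧸ J :=
  ((Ideal.Quotient.mk J : MonoidAlgebra ℤ Q →+* MonoidAlgebra ℤ Q ⧸ J) :
    MonoidAlgebra ℤ Q →* MonoidAlgebra ℤ Q ⧸ J).comp (MonoidAlgebra.of ℤ Q)

/-- The subring of `ℤQ / J` generated by the image of a subgroup `P` of `Q`. -/
noncomputable def subringGenBy {Q : Type*} [CommGroup Q] (J : Ideal (MonoidAlgebra ℤ Q))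
    (P : Subgroup Q) : Subring (MonoidAlgebra ℤ Q ⧸ J) :=
  Subring.closure (groupToQuot J '' (P : Set Q))

/-- The canonical map from a subgroup `P` of `Q` to the subring of `ℤQ / J` it generates. -/
noncomputable def subgroupToSubring {Q : Type*} [CommGroup Q] (J : Ideal (MonoidAlgebra ℤ Q))
    (P : Subgroup Q) (p : P) : subringGenBy J P :=
  ⟨groupToQuot J p, Subring.subset_closure ⟨p, p.2, rfl⟩⟩

/-- The subgroup of `Q` generated by two elements. -/
def twoGen {Q : Type*} [CommGroup Q] (a b : Q) : Subgroup Q :=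
  Subgroup.closure {a, b}

/-- The first generator, as an element of the subgroup. -/
def twoGen.fst {Q : Type*} [CommGroup Q] (a b : Q) : twoGen a b :=
  ⟨a, Subgroup.subset_closure (Or.inl rfl)⟩

/-- The second generator, as an element of the subgroup. -/
def twoGen.snd {Q : Type*} [CommGroup Q] (a b : Q) : twoGen a b :=
  ⟨b, Subgroup.subset_closure (Or.inr rfl)⟩

/-! Let `Ω` be an algebraic closure of `Frac R` and `k` the algebraic closure of `ℚ` in `Ω`; write
`x, y` for the images in `Ω`. Since `ℤQ` has dimension at least 3, `J ≠ 0`, so `x, y` satisfy a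
Laurent relation, while every nontrivial monomial is transcendental over `k`. The map `φ` extends to
an endomorphism `σ` of `Ω` (`exists_endomorphism_extending`), and `σ^j` sends `x^(n^j), y^(n^j)` to
`x^(c₁^j), y^(c₂^j)`.

The invariant is `d(p,q) = [k(x^p, y^q) : k(x^p)]`. As `σ` maps `k` onto itself, `d(n^j, n^j) =
d(c₁^j, c₂^j)`. By the tower law `d(p,q)` is `p` times a constant, divided by `[k(x,y) : k(x^p,
y^q)]`, and this index is bounded independently of `p, q` (`exists_relfinrank_adjoin_pow_pow_le`).
So `n^j` and `c₁^j` agree up to a bounded factor for all `j`, forcing `n = c₁`; exchanging `x` and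
`y` gives `n = c₂`. -/

/-! ### Independence of Laurent monomials -/

theorem linearIndependent_zpow_of_transcendental {F Ω : Type*} [CommRing F] [Field Ω] [Algebra F Ω]
    {z : Ω} (hz : Transcendental F z) (hz0 : z ≠ 0) :
    LinearIndependent F (fun i : ℤ => z ^ i) := by
  rw [linearIndependent_iff']
  intro s g hg i hi
  obtain ⟨N, hN⟩ : ∃ N : ℕ, ∀ j ∈ s, 0 ≤ j + N := by
    -- A crude shift that makes every exponent in `s` nonnegative.
    refine ⟨∑ j ∈ s, j.natAbs, fun j hj => ?_⟩
    have : j.natAbs ≤ ∑ j ∈ s, j.natAbs :=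
      Finset.single_le_sum (f := fun j : ℤ => j.natAbs) (fun _ _ => Nat.zero_le _) hj
    omega
  set P : Polynomial F := ∑ j ∈ s, Polynomial.monomial (j + N).toNat (g j) with hP
  have hPz : Polynomial.aeval z P = 0 := by
    have h1 : Polynomial.aeval z P = z ^ N * ∑ j ∈ s, g j • z ^ j := by
      rw [hP, map_sum, Finset.mul_sum]
      refine Finset.sum_congr rfl fun j hj => ?_
      rw [Polynomial.aeval_monomial, ← Algebra.smul_def, mul_smul_comm]
      congr 1
      rw [← zpow_natCast, Int.toNat_of_nonneg (hN j hj), zpow_add₀ hz0, zpow_natCast, mul_comm]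
    rw [h1, hg, mul_zero]
  have hP0 : P = 0 := by
    by_contra h
    exact hz ⟨P, h, hPz⟩
  have hc : P.coeff (i + N).toNat = g i := by
    rw [hP, Polynomial.finsetSum_coeff, Finset.sum_eq_single i]
    · simp
    · intro j hj hji
      rw [Polynomial.coeff_monomial, if_neg]
      have := hN j hj
      have := hN i hi
      omega
    · intro h
      exact absurd hi h
  rw [← hc, hP0, Polynomial.coeff_zero]

/-- Used in contrapositive form, to make `y` algebraic over `C`. The ring `C` is `k(x)` in one
application and a relative algebraic closure of `ℤ[X]` in the other. -/
theorem linearIndependent_zpow_mul_zpow {k C Ω : Type*} [CommRing k] [CommRing C] [Field Ω]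
    [Algebra k Ω] [Algebra k C] [Algebra C Ω] [IsScalarTower k C Ω] [FaithfulSMul C Ω]
    {x y : Ω} (hx : Transcendental k x)
    (hx0 : x ≠ 0) (hy0 : y ≠ 0) (hxC : ∀ i : ℤ, x ^ i ∈ Set.range (algebraMap C Ω))
    (hy : Transcendental C y) :
    LinearIndependent k (fun p : ℤ × ℤ => x ^ p.1 * y ^ p.2) := by
  choose b hb using hxC
  have h1 : LinearIndependent k b := by
    refine LinearIndependent.of_comp (IsScalarTower.toAlgHom k C Ω).toLinearMap ?_
    convert linearIndependent_zpow_of_transcendental hx hx0 using 1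
    ext i
    simp [hb]
  have h2 := linearIndependent_smul h1 (linearIndependent_zpow_of_transcendental hy hy0)
  convert h2 using 1
  ext p
  simp [Algebra.smul_def, hb]

/-! ### Minimal relations and their twists -/

theorem exists_minimal_support_relation {k V ι : Type*} [Ring k] [AddCommGroup V] [Module k V]
    {v : ι → V} (hv : ¬ LinearIndependent k v) :
    ∃ g : ι →₀ k, g ≠ 0 ∧ Finsupp.linearCombination k v g = 0 ∧
      ∀ h : ι →₀ k, Finsupp.linearCombination k v h = 0 → h.support ⊂ g.support → h = 0 := by
  have hne : {g : ι →₀ k | g ≠ 0 ∧ Finsupp.linearCombination k v g = 0}.Nonempty := by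
    rw [linearIndependent_iff] at hv
    push Not at hv
    obtain ⟨g, h1, h2⟩ := hv
    exact ⟨g, h2, h1⟩
  have wf := InvImage.wf (fun g : ι →₀ k => g.support.card) Nat.lt_wfRel.wf
  obtain ⟨g, ⟨hg0, hg⟩, hmin⟩ := wf.has_min _ hne
  refine ⟨g, hg0, hg, fun h h1 h2 => ?_⟩
  by_contra h0
  exact hmin h ⟨h0, h1⟩ (Finset.card_lt_card h2)

/-- Twisting multiplies the coefficient at `p` by `c p`. Subtracting `c t` times `g` cancels the
coefficient at `t`, so minimality kills the whole difference. -/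
theorem twist_const_on_support {k Ω : Type*} [Field k] [Field Ω] [Algebra k Ω] {x y : Ω}
    {g : ℤ × ℤ →₀ k}
    (hmin : ∀ h : ℤ × ℤ →₀ k,
      Finsupp.linearCombination k (fun p : ℤ × ℤ => x ^ p.1 * y ^ p.2) h = 0 →
        h.support ⊂ g.support → h = 0)
    (hg : Finsupp.linearCombination k (fun p : ℤ × ℤ => x ^ p.1 * y ^ p.2) g = 0)
    {ζ ξ : k}
    (hg' : Finsupp.linearCombination k (fun p : ℤ × ℤ =>
      (algebraMap k Ω ζ * x) ^ p.1 * (algebraMap k Ω ξ * y) ^ p.2) g = 0)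
    {s t : ℤ × ℤ} (hs : s ∈ g.support) (ht : t ∈ g.support) :
    ζ ^ s.1 * ξ ^ s.2 = ζ ^ t.1 * ξ ^ t.2 := by
  set c : ℤ × ℤ → k := fun p => ζ ^ p.1 * ξ ^ p.2 with hc
  let h : ℤ × ℤ →₀ k := Finsupp.onFinset g.support (fun p => g p * (c p - c t)) (by
    intro p hp
    rw [Finsupp.mem_support_iff]
    exact left_ne_zero_of_mul hp)
  have hh : Finsupp.linearCombination k (fun p : ℤ × ℤ => x ^ p.1 * y ^ p.2) h = 0 := by
    rw [Finsupp.linearCombination_apply, Finsupp.onFinset_sum _ (by simp)]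
    rw [Finsupp.linearCombination_apply, Finsupp.sum] at hg hg'
    calc _ = ∑ p ∈ g.support, (g p • ((algebraMap k Ω ζ * x) ^ p.1 * (algebraMap k Ω ξ * y) ^ p.2)
            - algebraMap k Ω (c t) * (g p • (x ^ p.1 * y ^ p.2))) := by
          refine Finset.sum_congr rfl fun p _ => ?_
          simp only [Algebra.smul_def, hc, map_mul, map_sub, map_zpow₀, mul_zpow]
          ring
      _ = 0 := by rw [Finset.sum_sub_distrib, hg', ← Finset.mul_sum, hg, mul_zero, sub_zero]
  have h0 : h = 0 := by
    refine hmin h hh ?_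
    refine (Finset.ssubset_iff_of_subset Finsupp.support_onFinset_subset).2 ⟨t, ht, ?_⟩
    simp
  have h1 : g s * (c s - c t) = 0 := by
    have := DFunLike.congr_fun h0 s
    simpa only [h, Finsupp.onFinset_apply, Finsupp.coe_zero, Pi.zero_apply] using this
  exact sub_eq_zero.1 ((mul_eq_zero.1 h1).resolve_left (Finsupp.mem_support_iff.1 hs))

theorem exists_primitive_direction {u v : ℤ} (h : (u, v) ≠ (0, 0)) :
    ∃ a b : ℤ, (a, b) ≠ (0, 0) ∧ ∀ u' v' : ℤ, u * v' = v * u' → ∃ t : ℤ, u' = t * a ∧ v' = t * b := by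
  have hpos : 0 < Int.gcd u v := by
    rw [Int.gcd_pos_iff]
    by_contra hh
    push Not at hh
    exact h (by rw [hh.1, hh.2])
  obtain ⟨a, b, hab, hu, hv⟩ := Int.exists_gcd_one hpos
  have hd : (Int.gcd u v : ℤ) ≠ 0 := by exact_mod_cast hpos.ne'
  refine ⟨a, b, ?_, fun u' v' huv => ?_⟩
  · rintro hab0
    rw [Prod.mk.injEq] at hab0
    rw [hab0.1, hab0.2] at hab
    simp at hab
  · have e : a * v' = b * u' := by
      apply mul_right_cancel₀ hd
      calc a * v' * (Int.gcd u v : ℤ) = (a * (Int.gcd u v : ℤ)) * v' := by ring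
        _ = (b * (Int.gcd u v : ℤ)) * u' := by rw [← hu, ← hv, huv]
        _ = _ := by ring
    have hb := Int.gcd_eq_gcd_ab a b
    rw [hab] at hb
    refine ⟨u' * Int.gcdA a b + v' * Int.gcdB a b, ?_, ?_⟩
    · linear_combination u' * hb - Int.gcdB a b * e
    · linear_combination v' * hb + Int.gcdA a b * e

/-- If the support lay on a line, dividing by one monomial would leave a relation among powers of a
single `x^a * y^b`, which is transcendental. So two exponent differences are independent, and
Cramer's rule works with `D` the absolute value of their determinant. -/
theorem exists_pow_eq_one_of_const_on_support {k Ω : Type*} [Field k] [Field Ω] [Algebra k Ω]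
    {x y : Ω} (hx0 : x ≠ 0) (hy0 : y ≠ 0)
    (htr : ∀ i j : ℤ, (i, j) ≠ (0, 0) → Transcendental k (x ^ i * y ^ j))
    {g : ℤ × ℤ →₀ k} (hg0 : g ≠ 0)
    (hg : Finsupp.linearCombination k (fun p : ℤ × ℤ => x ^ p.1 * y ^ p.2) g = 0) :
    ∃ D : ℕ, 0 < D ∧ ∀ ζ ξ : k, ζ ≠ 0 → ξ ≠ 0 →
      (∀ s ∈ g.support, ∀ t ∈ g.support, ζ ^ s.1 * ξ ^ s.2 = ζ ^ t.1 * ξ ^ t.2) →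
      ζ ^ D = 1 ∧ ξ ^ D = 1 := by
  obtain ⟨s, hs⟩ := Finsupp.support_nonempty_iff.2 hg0
  have key : ∃ t ∈ g.support, ∃ t' ∈ g.support,
      (t.1 - s.1) * (t'.2 - s.2) - (t.2 - s.2) * (t'.1 - s.1) ≠ 0 := by
    by_contra hcon
    push Not at hcon
    obtain ⟨a, b, hab, hdir⟩ : ∃ a b : ℤ, (a, b) ≠ (0, 0) ∧ ∀ t ∈ g.support,
        ∃ m : ℤ, t.1 - s.1 = m * a ∧ t.2 - s.2 = m * b := by
      by_cases hall : ∀ t ∈ g.support, t = s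
      · refine ⟨1, 0, by simp, fun t ht => ⟨0, ?_⟩⟩
        simp [hall t ht]
      · push Not at hall
        obtain ⟨t, ht, hts⟩ := hall
        obtain ⟨a, b, hab, h⟩ := exists_primitive_direction (u := t.1 - s.1) (v := t.2 - s.2) (by
          intro h
          rw [Prod.mk.injEq, sub_eq_zero, sub_eq_zero] at h
          exact hts (Prod.ext h.1 h.2))
        exact ⟨a, b, hab, fun t' ht' => h _ _ (sub_eq_zero.1 (hcon t ht t' ht'))⟩
    choose! m hm using hdir
    have hz0 : x ^ a * y ^ b ≠ 0 := mul_ne_zero (zpow_ne_zero _ hx0) (zpow_ne_zero _ hy0)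
    have hli := linearIndependent_zpow_of_transcendental (htr a b hab) hz0
    have hinj : Set.InjOn m g.support := by
      intro t ht t' ht' e
      have h1 := hm t ht
      have h2 := hm t' ht'
      rw [e] at h1
      exact Prod.ext (by linarith [h1.1, h2.1]) (by linarith [h1.2, h2.2])
    have hli' : LinearIndepOn k (fun p : ℤ × ℤ => (x ^ a * y ^ b) ^ m p) (g.support : Set (ℤ × ℤ)) :=
      hli.comp (fun p : (g.support : Set (ℤ × ℤ)) => m p) (fun p q e =>
        Subtype.ext (hinj p.2 q.2 e))
    rw [linearIndepOn_finset_iff] at hli'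
    refine Finsupp.mem_support_iff.1 hs (hli' g ?_ s hs)
    have hxy : x ^ s.1 * y ^ s.2 ≠ 0 := mul_ne_zero (zpow_ne_zero _ hx0) (zpow_ne_zero _ hy0)
    apply mul_left_cancel₀ hxy
    rw [mul_zero, ← hg, Finsupp.linearCombination_apply, Finsupp.sum, Finset.mul_sum]
    refine Finset.sum_congr rfl fun t ht => ?_
    rw [mul_smul_comm]
    congr 1
    have h1 : t.1 = s.1 + a * m t := by linarith [(hm t ht).1]
    have h2 : t.2 = s.2 + b * m t := by linarith [(hm t ht).2]
    rw [h1, h2, mul_zpow, zpow_add₀ hx0, zpow_add₀ hy0, zpow_mul, zpow_mul]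
    ring
  obtain ⟨t, ht, t', ht', hD⟩ := key
  set u := t.1 - s.1
  set v := t.2 - s.2
  set u' := t'.1 - s.1
  set v' := t'.2 - s.2
  refine ⟨(u * v' - v * u').natAbs, Int.natAbs_pos.2 hD, fun ζ ξ hζ hξ hc => ?_⟩
  have diff : ∀ r ∈ g.support, ζ ^ (r.1 - s.1) * ξ ^ (r.2 - s.2) = 1 := by
    intro r hr
    rw [zpow_sub₀ hζ, zpow_sub₀ hξ, div_mul_div_comm, hc r hr s hs, div_self]
    exact mul_ne_zero (zpow_ne_zero _ hζ) (zpow_ne_zero _ hξ)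
  have e1 : ζ ^ u * ξ ^ v = 1 := diff t ht
  have e2 : ζ ^ u' * ξ ^ v' = 1 := diff t' ht'
  have f1 : ζ ^ (u * v' - v * u') = 1 := by
    calc ζ ^ (u * v' - v * u') = (ζ ^ u * ξ ^ v) ^ v' / (ζ ^ u' * ξ ^ v') ^ v := by
          rw [mul_zpow, mul_zpow, ← zpow_mul, ← zpow_mul, ← zpow_mul, ← zpow_mul, zpow_sub₀ hζ,
            mul_comm v' v, mul_comm v u', mul_div_mul_right]
          exact zpow_ne_zero _ hξ
      _ = 1 := by simp [e1, e2]
  have f2 : ξ ^ (u * v' - v * u') = 1 := by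
    calc ξ ^ (u * v' - v * u') = (ζ ^ u' * ξ ^ v') ^ u / (ζ ^ u * ξ ^ v) ^ u' := by
          rw [mul_zpow, mul_zpow, ← zpow_mul, ← zpow_mul, ← zpow_mul, ← zpow_mul, zpow_sub₀ hξ,
            mul_comm u' u, mul_comm v' u, mul_div_mul_left]
          exact zpow_ne_zero _ hζ
      _ = 1 := by simp [e1, e2]
  constructor
  · rcases Int.natAbs_eq (u * v' - v * u') with h | h
    · rw [h, zpow_natCast] at f1; exact f1
    · rw [h, zpow_neg, inv_eq_one, zpow_natCast] at f1; exact f1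
  · rcases Int.natAbs_eq (u * v' - v * u') with h | h
    · rw [h, zpow_natCast] at f2; exact f2
    · rw [h, zpow_neg, inv_eq_one, zpow_natCast] at f2; exact f2

/-! ### Degrees of the fields `k(x^p, y^q)` -/

open IntermediateField in
theorem relfinrank_adjoin_pow {k Ω : Type*} [Field k] [Field Ω] [Algebra k Ω] {x : Ω}
    (hx : Transcendental k x) (p : ℕ) :
    relfinrank (adjoin k {x ^ p}) (adjoin k {x}) = p := by
  have hinj : Function.Injective (Polynomial.aeval (R := k) x) :=
    transcendental_iff_injective.1 hx
  let f : RatFunc k →ₐ[k] Ω := IsFractionRing.liftAlgHom (K := RatFunc k) hinj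
  have hf : f RatFunc.X = x := by
    rw [← RatFunc.algebraMap_X, IsFractionRing.liftAlgHom_apply, IsFractionRing.lift_algebraMap]
    simp
  have e1 : adjoin k {x ^ p} = (adjoin k {(RatFunc.X : RatFunc k) ^ p}).map f := by
    rw [adjoin_map, Set.image_singleton, map_pow, hf]
  have e2 : adjoin k {x} = (⊤ : IntermediateField k (RatFunc k)).map f := by
    rw [← RatFunc.adjoin_X, adjoin_map, Set.image_singleton, hf]
  rw [e1, e2, relfinrank_map_map, relfinrank_top_right, RatFunc.finrank_eq_max_natDegree]
  have e3 : (RatFunc.X : RatFunc k) ^ p = algebraMap (Polynomial k) (RatFunc k) (Polynomial.X ^ p) := by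
    rw [map_pow, RatFunc.algebraMap_X]
  rw [e3, RatFunc.num_algebraMap, RatFunc.denom_algebraMap]
  simp

theorem IsAlgClosed.mem_range_algebraMap_of_isIntegral {k Ω : Type*} [Field k] [IsAlgClosed k]
    [Field Ω] [Algebra k Ω] {z : Ω} (hz : IsIntegral k z) : z ∈ Set.range (algebraMap k Ω) :=
  minpoly.mem_range_of_degree_eq_one k z
    (IsAlgClosed.degree_eq_one_of_irreducible k (minpoly.irreducible hz))

theorem exists_eq_algebraMap_mul_of_pow_eq {k Ω : Type*} [Field k] [IsAlgClosed k]
    [Field Ω] [Algebra k Ω] {z w : Ω} (hz : z ≠ 0) {p : ℕ} (hp : 0 < p) (h : w ^ p = z ^ p) :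
    ∃ ζ : k, ζ ≠ 0 ∧ w = algebraMap k Ω ζ * z := by
  have h1 : (w / z) ^ p = 1 := by rw [div_pow, h, div_self (pow_ne_zero _ hz)]
  obtain ⟨ζ, hζ⟩ := IsAlgClosed.mem_range_algebraMap_of_isIntegral (k := k) (z := w / z)
    (IsIntegral.of_pow hp (by rw [h1]; exact isIntegral_one))
  refine ⟨ζ, ?_, by rw [hζ, div_mul_cancel₀ _ hz]⟩
  rintro rfl
  rw [map_zero] at hζ
  rw [← hζ, zero_pow hp.ne'] at h1
  exact zero_ne_one h1

-- The degree counts embeddings over `k(x^p, y^q)`. Each scales `x` and `y` by roots of unity of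
-- `k`, hence twists the minimal relation, so both scalars are `D`-th roots of unity with `D`
-- independent of `p, q`.
open IntermediateField in
theorem exists_relfinrank_adjoin_pow_pow_le {k Ω : Type*} [Field k] [IsAlgClosed k]
    [Field Ω] [IsAlgClosed Ω] [CharZero Ω] [Algebra k Ω] {x y : Ω} (hx0 : x ≠ 0) (hy0 : y ≠ 0)
    (htr : ∀ i j : ℤ, (i, j) ≠ (0, 0) → Transcendental k (x ^ i * y ^ j))
    (hdep : ¬ LinearIndependent k (fun p : ℤ × ℤ => x ^ p.1 * y ^ p.2)) :
    ∃ B : ℕ, ∀ p q : ℕ, 0 < p → 0 < q →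
      0 < relfinrank (adjoin k {x ^ p, y ^ q}) (adjoin k {x, y}) ∧
      relfinrank (adjoin k {x ^ p, y ^ q}) (adjoin k {x, y}) ≤ B := by
  classical
  obtain ⟨g, hg0, hg, hmin⟩ := exists_minimal_support_relation hdep
  obtain ⟨D, hD, hDpow⟩ := exists_pow_eq_one_of_const_on_support hx0 hy0 htr hg0 hg
  refine ⟨D * D, fun p q hp hq => ?_⟩
  set M := adjoin k {x ^ p, y ^ q} with hM
  have hxM : x ^ p ∈ M := subset_adjoin _ _ (by simp)
  have hyM : y ^ q ∈ M := subset_adjoin _ _ (by simp)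
  have hle : M ≤ adjoin k {x, y} := by
    rw [hM, adjoin_le_iff]
    rintro z (rfl | rfl)
    · exact pow_mem (subset_adjoin k {x, y} (by simp)) _
    · exact pow_mem (subset_adjoin k {x, y} (by simp)) _
  rw [relfinrank_eq_finrank_of_le hle, extendScalars_adjoin hle]
  set N := adjoin M {x, y} with hN
  have : FiniteDimensional M N := by
    refine finiteDimensional_adjoin ?_
    rintro z (rfl | rfl)
    · exact IsIntegral.of_pow hp (isIntegral_algebraMap (x := (⟨_, hxM⟩ : M)))
    · exact IsIntegral.of_pow hq (isIntegral_algebraMap (x := (⟨_, hyM⟩ : M)))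
  -- Positivity encodes finiteness, as an infinite degree is recorded as 0.
  refine ⟨Module.finrank_pos, ?_⟩
  rw [← AlgHom.card M N Ω]
  let X : N := ⟨x, subset_adjoin _ _ (by simp)⟩
  let Y : N := ⟨y, subset_adjoin _ _ (by simp)⟩
  have hX : algebraMap N Ω X = x := rfl
  have hY : algebraMap N Ω Y = y := rfl
  have hXp : X ^ p = algebraMap M N ⟨x ^ p, hxM⟩ := Subtype.ext rfl
  have hYq : Y ^ q = algebraMap M N ⟨y ^ q, hyM⟩ := Subtype.ext rfl
  -- The relation must live in `N` for an embedding `τ` to be applied to it.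
  have hrel : Finsupp.linearCombination k (fun r : ℤ × ℤ => X ^ r.1 * Y ^ r.2) g = 0 := by
    apply (N.val.restrictScalars k).injective
    rw [map_zero, ← hg]
    change (N.val.restrictScalars k).toLinearMap _ = _
    rw [Finsupp.apply_linearCombination]
    rfl
  have key : ∀ τ : N →ₐ[M] Ω, τ X ^ D = x ^ D ∧ τ Y ^ D = y ^ D := by
    intro τ
    obtain ⟨ζ, hζ0, hζ⟩ := exists_eq_algebraMap_mul_of_pow_eq (k := k) (w := τ X) hx0 hp (by
      rw [← map_pow, hXp, τ.commutes]; rfl)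
    obtain ⟨ξ, hξ0, hξ⟩ := exists_eq_algebraMap_mul_of_pow_eq (k := k) (w := τ Y) hy0 hq (by
      rw [← map_pow, hYq, τ.commutes]; rfl)
    have hg' : Finsupp.linearCombination k (fun r : ℤ × ℤ =>
        (algebraMap k Ω ζ * x) ^ r.1 * (algebraMap k Ω ξ * y) ^ r.2) g = 0 := by
      have := congrArg (τ.restrictScalars k).toLinearMap hrel
      rw [map_zero, Finsupp.apply_linearCombination] at this
      rw [← this]
      congr 2
      ext r
      simp [← hζ, ← hξ]
    obtain ⟨e1, e2⟩ := hDpow ζ ξ hζ0 hξ0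
      (fun s hs t ht => twist_const_on_support hmin hg hg' hs ht)
    rw [hζ, hξ, mul_pow, mul_pow, ← map_pow, ← map_pow, e1, e2, map_one, one_mul, one_mul]
    exact ⟨rfl, rfl⟩
  let T := (Polynomial.nthRoots D (x ^ D)).toFinset ×ˢ (Polynomial.nthRoots D (y ^ D)).toFinset
  calc Fintype.card (N →ₐ[M] Ω) = (Finset.univ : Finset (N →ₐ[M] Ω)).card := rfl
    _ ≤ T.card := by
        refine Finset.card_le_card_of_injOn (fun τ => (τ X, τ Y)) (fun τ _ => ?_) ?_
        · simp only [T, Finset.coe_product, Set.mem_prod, Finset.mem_coe, Multiset.mem_toFinset,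
            Polynomial.mem_nthRoots hD]
          exact key τ
        · intro τ _ τ' _ h
          rw [Prod.mk.injEq] at h
          refine algHom_ext_of_eq_adjoin M (s := {x, y}) hN ?_
          rintro z (rfl | rfl)
          · exact h.1
          · exact h.2
    _ ≤ D * D := by
        rw [Finset.card_product]
        exact Nat.mul_le_mul ((Multiset.toFinset_card_le _).trans (Polynomial.card_nthRoots _ _))
          ((Multiset.toFinset_card_le _).trans (Polynomial.card_nthRoots _ _))

open IntermediateField in
theorem relfinrank_adjoin_pair_pos {k Ω : Type*} [Field k] [Field Ω] [Algebra k Ω] {x y : Ω}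
    (hy : IsAlgebraic (adjoin k {x}) y) : 0 < relfinrank (adjoin k {x}) (adjoin k {x, y}) := by
  have hle : adjoin k {x} ≤ adjoin k {x, y} := adjoin.mono _ _ _ (by simp)
  rw [relfinrank_eq_finrank_of_le hle, extendScalars_adjoin hle]
  have : FiniteDimensional (adjoin k {x}) (adjoin (adjoin k {x}) {x, y}) := by
    refine finiteDimensional_adjoin ?_
    rintro z (rfl | rfl)
    · exact isIntegral_algebraMap (x := (⟨z, subset_adjoin _ _ (by simp)⟩ : adjoin k {z}))
    · exact hy.isIntegral
  exact Module.finrank_pos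

open IntermediateField in
/-- If `x` and `y` are dependent over the algebraically closed field `k` but no nontrivial monomial
in them lies in `k`, then `[k(x^p, y^q) : k(x^p)]` is `p` up to a bounded factor. -/
theorem exists_relfinrank_bounds {k Ω : Type*} [Field k] [IsAlgClosed k]
    [Field Ω] [IsAlgClosed Ω] [CharZero Ω] [Algebra k Ω] {x y : Ω} (hx0 : x ≠ 0) (hy0 : y ≠ 0)
    (htr : ∀ i j : ℤ, (i, j) ≠ (0, 0) → Transcendental k (x ^ i * y ^ j))
    (hdep : ¬ LinearIndependent k (fun p : ℤ × ℤ => x ^ p.1 * y ^ p.2)) :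
    ∃ A B : ℕ, 0 < A ∧ ∀ p q : ℕ, 0 < p → 0 < q →
      relfinrank (adjoin k {x ^ p}) (adjoin k {x ^ p, y ^ q}) ≤ p * A ∧
      p * A ≤ relfinrank (adjoin k {x ^ p}) (adjoin k {x ^ p, y ^ q}) * B := by
  have hx : Transcendental k x := by simpa using htr 1 0 (by simp)
  have hy : IsAlgebraic (adjoin k {x}) y := by
    by_contra hy
    refine hdep (linearIndependent_zpow_mul_zpow (C := adjoin k {x}) hx hx0 hy0 (fun i => ?_) hy)
    exact ⟨⟨x ^ i, zpow_mem (subset_adjoin _ _ (by simp)) _⟩, rfl⟩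
  obtain ⟨B, hB⟩ := exists_relfinrank_adjoin_pow_pow_le hx0 hy0 htr hdep
  refine ⟨relfinrank (adjoin k {x}) (adjoin k {x, y}), B, relfinrank_adjoin_pair_pos hy,
    fun p q hp hq => ?_⟩
  obtain ⟨h1, h2⟩ := hB p q hp hq
  have hle1 : adjoin k {x ^ p} ≤ adjoin k {x ^ p, y ^ q} := adjoin.mono _ _ _ (by simp)
  have hle2 : adjoin k {x ^ p, y ^ q} ≤ adjoin k {x, y} := by
    rw [adjoin_le_iff]
    rintro z (rfl | rfl)
    · exact pow_mem (subset_adjoin k {x, y} (by simp)) _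
    · exact pow_mem (subset_adjoin k {x, y} (by simp)) _
  have hle3 : adjoin k {x ^ p} ≤ adjoin k {x} := by
    rw [adjoin_simple_le_iff]
    exact pow_mem (subset_adjoin k {x} (by simp)) _
  have hle4 : adjoin k {x} ≤ adjoin k {x, y} := adjoin.mono _ _ _ (by simp)
  -- `[k(x,y) : k(x^p)]`, computed through `k(x^p, y^q)` and through `k(x)`.
  have e : relfinrank (adjoin k {x ^ p}) (adjoin k {x ^ p, y ^ q}) *
      relfinrank (adjoin k {x ^ p, y ^ q}) (adjoin k {x, y}) =
      p * relfinrank (adjoin k {x}) (adjoin k {x, y}) := by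
    rw [relfinrank_mul_relfinrank hle1 hle2, ← relfinrank_mul_relfinrank hle3 hle4,
      relfinrank_adjoin_pow hx]
  rw [← e]
  exact ⟨Nat.le_mul_of_pos_right _ h1, Nat.mul_le_mul_left _ h2⟩

/-! ### Endomorphisms and the growth of degrees -/

theorem Nat.le_of_forall_pow_le_pow_mul {n c B : ℕ} (hc : 0 < c) (h : ∀ j, n ^ j ≤ c ^ j * B) :
    n ≤ c := by
  by_contra! hlt
  have hc' : (0 : ℝ) < c := by exact_mod_cast hc
  have h1 : (1 : ℝ) < n / c := by
    rw [one_lt_div hc']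
    exact_mod_cast hlt
  obtain ⟨j, hj⟩ := pow_unbounded_of_one_lt (B : ℝ) h1
  rw [div_pow, lt_div_iff₀ (pow_pos hc' j)] at hj
  have h2 : (n : ℝ) ^ j ≤ (c : ℝ) ^ j * B := by exact_mod_cast h j
  linarith

/-- `τ` need not be surjective, but a self-embedding of an algebraic extension is. -/
theorem map_algebraicClosure_rat {Ω : Type*} [Field Ω] [CharZero Ω] (τ : Ω →+* Ω) :
    (algebraicClosure ℚ Ω).toSubfield.map τ = (algebraicClosure ℚ Ω).toSubfield := by
  let k := algebraicClosure ℚ Ω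
  let τ' : Ω →ₐ[ℚ] Ω := τ.toRatAlgHom
  have hmem : ∀ z : k, (τ'.comp k.val) z ∈ k.toSubalgebra := fun z =>
    (map_mem_algebraicClosure_iff τ').2 z.2
  have hbij := Algebra.IsAlgebraic.algHom_bijective ((τ'.comp k.val).codRestrict k.toSubalgebra hmem :
    k →ₐ[ℚ] k)
  ext z
  constructor
  · rintro ⟨w, hw, rfl⟩
    exact hmem ⟨w, hw⟩
  · intro hz
    obtain ⟨w, hw⟩ := hbij.2 ⟨z, hz⟩
    exact ⟨w, w.2, congrArg Subtype.val hw⟩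

open IntermediateField in
theorem map_adjoin_algebraicClosure_rat {Ω : Type*} [Field Ω] [CharZero Ω] (τ : Ω →+* Ω)
    (S : Set Ω) :
    (adjoin (algebraicClosure ℚ Ω) S).toSubfield.map τ =
      (adjoin (algebraicClosure ℚ Ω) (τ '' S)).toSubfield := by
  have hr : Set.range (algebraMap (algebraicClosure ℚ Ω) Ω) = algebraicClosure ℚ Ω :=
    Subtype.range_coe
  have h := congrArg (fun K : Subfield Ω => (K : Set Ω)) (map_algebraicClosure_rat τ)
  rw [adjoin_toSubfield, adjoin_toSubfield, RingHom.map_field_closure, Set.image_union, hr]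
  congr 2

open IntermediateField in
theorem relfinrank_adjoin_map {Ω : Type*} [Field Ω] [CharZero Ω] (τ : Ω →+* Ω) (u v : Ω) :
    relfinrank (adjoin (algebraicClosure ℚ Ω) {τ u}) (adjoin (algebraicClosure ℚ Ω) {τ u, τ v}) =
      relfinrank (adjoin (algebraicClosure ℚ Ω) {u}) (adjoin (algebraicClosure ℚ Ω) {u, v}) := by
  unfold relfinrank
  rw [← Set.image_singleton, ← Set.image_pair, ← map_adjoin_algebraicClosure_rat,
    ← map_adjoin_algebraicClosure_rat, Subfield.relfinrank_map_map]

theorem RingHom.pow_apply_pow_pow {Ω : Type*} [CommRing Ω] (σ : Ω →+* Ω) {x : Ω} {n c : ℕ}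
    (h : σ (x ^ n) = x ^ c) (j : ℕ) : (σ ^ j) (x ^ n ^ j) = x ^ c ^ j := by
  induction j with
  | zero => simp
  | succ j ih =>
    rw [pow_succ σ, RingHom.mul_def, RingHom.comp_apply, pow_succ' n, pow_mul x, map_pow σ, h,
      ← pow_mul, mul_comm, pow_mul, map_pow, ih, ← pow_mul, ← pow_succ]

/-- A multiplicatively nondegenerate, algebraically dependent pair `x, y` has no field endomorphism
taking `x ^ n` to `x ^ c₁` and `y ^ n` to `y ^ c₂` with `n ≠ c₁`. -/
theorem eq_exponent_of_endomorphism {Ω : Type*} [Field Ω] [IsAlgClosed Ω] [CharZero Ω] {x y : Ω}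
    (hx0 : x ≠ 0) (hy0 : y ≠ 0)
    (htr : ∀ i j : ℤ, (i, j) ≠ (0, 0) → Transcendental ℚ (x ^ i * y ^ j))
    (hdep : ¬ LinearIndependent ℤ (fun p : ℤ × ℤ => x ^ p.1 * y ^ p.2))
    {n c₁ c₂ : ℕ} (hn : 0 < n) (hc₁ : 0 < c₁) (hc₂ : 0 < c₂) (σ : Ω →+* Ω)
    (hσx : σ (x ^ n) = x ^ c₁) (hσy : σ (y ^ n) = y ^ c₂) : n = c₁ := by
  have hk : IsAlgClosed (algebraicClosure ℚ Ω) := (algebraicClosure.isAlgClosure ℚ Ω).isAlgClosed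
  obtain ⟨A, B, hA, hAB⟩ := exists_relfinrank_bounds (k := algebraicClosure ℚ Ω) hx0 hy0
    (fun i j hij => (htr i j hij).algebraicClosure)
    (fun h => hdep (h.restrict_scalars (fun a b hab => by
      simpa [zsmul_eq_mul] using hab)))
  -- The bounds do not involve the exponent of `y`, so `c₂` drops out.
  have key : ∀ j, n ^ j * A ≤ c₁ ^ j * A * B ∧ c₁ ^ j * A ≤ n ^ j * A * B := by
    intro j
    obtain ⟨h1, h2⟩ := hAB (n ^ j) (n ^ j) (pow_pos hn j) (pow_pos hn j)
    obtain ⟨h3, h4⟩ := hAB (c₁ ^ j) (c₂ ^ j) (pow_pos hc₁ j) (pow_pos hc₂ j)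
    have e := relfinrank_adjoin_map (σ ^ j) (x ^ n ^ j) (y ^ n ^ j)
    rw [σ.pow_apply_pow_pow hσx, σ.pow_apply_pow_pow hσy] at e
    rw [e] at h3 h4
    exact ⟨h2.trans (Nat.mul_le_mul_right _ h3), h4.trans (Nat.mul_le_mul_right _ h1)⟩
  refine le_antisymm (Nat.le_of_forall_pow_le_pow_mul (B := B) hc₁ fun j => ?_)
    (Nat.le_of_forall_pow_le_pow_mul (B := B) hn fun j => ?_)
  · exact Nat.le_of_mul_le_mul_right ((key j).1.trans_eq (by ring)) hA
  · exact Nat.le_of_mul_le_mul_right ((key j).2.trans_eq (by ring)) hA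

/-! ### Extending a homomorphism to the algebraic closure -/

/-- A nonzero element of `S` divides a nonzero element of `A`, so a nonzero kernel would meet `A`.
-/
theorem RingHom.injective_of_injective_comp_algebraMap {A S M : Type*} [CommRing A] [CommRing S]
    [IsDomain S] [Algebra A S] [Algebra.IsAlgebraic A S] [CommRing M] (f : S →+* M)
    (hf : Function.Injective (f.comp (algebraMap A S))) : Function.Injective f := by
  rw [injective_iff_map_eq_zero]
  intro s hs
  by_contra hs0
  obtain ⟨a, ha, b, hb⟩ := (Algebra.IsAlgebraic.isAlgebraic (R := A) s).exists_nonzero_dvd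
    (mem_nonZeroDivisors_of_ne_zero hs0)
  refine ha ((injective_iff_map_eq_zero _).1 hf a ?_)
  rw [RingHom.comp_apply, hb, map_mul, hs, zero_mul]

theorem IsAlgClosed.exists_ringHom_extension {A S Ω M : Type*} [CommRing A] [IsDomain A]
    [CommRing S] [IsDomain S]
    [Field Ω] [Field M] [IsAlgClosed M] [Algebra A S] [Algebra S Ω] [Algebra A Ω]
    [IsScalarTower A S Ω] [FaithfulSMul S Ω] [Algebra.IsAlgebraic A Ω] (f : S →+* M)
    (hf : Function.Injective (f.comp (algebraMap A S))) :
    ∃ g : Ω →+* M, ∀ s, g (algebraMap S Ω s) = f s := by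
  have hSΩ : Function.Injective (algebraMap S Ω) := FaithfulSMul.algebraMap_injective S Ω
  have : Algebra.IsAlgebraic A S :=
    ⟨fun s => (isAlgebraic_algebraMap_iff hSΩ).1 (Algebra.IsAlgebraic.isAlgebraic _)⟩
  have hinj := f.injective_of_injective_comp_algebraMap hf
  have hAS : Function.Injective (algebraMap A S) := Function.Injective.of_comp hf
  have : Algebra.IsAlgebraic S Ω :=
    ⟨fun z => (Algebra.IsAlgebraic.isAlgebraic (R := A) z).extendScalars hAS⟩
  let := f.toAlgebra
  have : FaithfulSMul S M := (faithfulSMul_iff_algebraMap_injective S M).2 hinj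
  exact ⟨(IsAlgClosed.lift (R := S) (S := Ω) (M := M)).toRingHom, fun s =>
    (IsAlgClosed.lift (R := S) (S := Ω) (M := M)).commutes s⟩

theorem isAlgebraic_of_algebraMap_X_eq_pow {Ω : Type*} [Field Ω] [CharZero Ω]
    [Algebra (Polynomial ℤ) Ω] {x y : Ω} (hx : Transcendental ℤ x) (hx0 : x ≠ 0) (hy0 : y ≠ 0)
    (hdep : ¬ LinearIndependent ℤ (fun p : ℤ × ℤ => x ^ p.1 * y ^ p.2)) {n : ℕ} (hn : 0 < n)
    (hX : algebraMap (Polynomial ℤ) Ω Polynomial.X = x ^ n) :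
    IsAlgebraic (Polynomial ℤ) x ∧ IsAlgebraic (Polynomial ℤ) y := by
  have hxalg : IsAlgebraic (Polynomial ℤ) x :=
    (IsIntegral.of_pow hn (hX ▸ isIntegral_algebraMap)).isAlgebraic
  refine ⟨hxalg, ?_⟩
  let C := Subalgebra.algebraicClosure (Polynomial ℤ) Ω
  have : Algebra.IsAlgebraic (Polynomial ℤ) C :=
    ⟨fun c => (isAlgebraic_algebraMap_iff (A := Ω) Subtype.val_injective).1 c.2⟩
  by_contra hy
  have hyC : Transcendental C y := fun h => hy (h.restrictScalars (Polynomial ℤ))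
  have hxC : x ∈ C := hxalg
  have hxC' : x⁻¹ ∈ C := hxalg.inv
  refine hdep (linearIndependent_zpow_mul_zpow (C := C) hx hx0 hy0 (fun i => ?_) hyC)
  refine ⟨⟨x ^ i, ?_⟩, rfl⟩
  rcases Int.eq_nat_or_neg i with ⟨m, rfl | rfl⟩
  · rw [zpow_natCast]
    exact pow_mem hxC m
  · rw [zpow_neg, zpow_natCast, ← inv_pow]
    exact pow_mem hxC' m

theorem Algebra.isAlgebraic_of_generated {A R Ω : Type*} [CommRing A] [IsDomain A] [CommRing R]
    [IsDomain R] [Field Ω] [Algebra A Ω] [Algebra R Ω] [FaithfulSMul R Ω] [Algebra.IsAlgebraic R Ω]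
    (h : ∀ r : R, IsAlgebraic A (algebraMap R Ω r)) : Algebra.IsAlgebraic A Ω := by
  let C := Subalgebra.algebraicClosure A Ω
  have : Algebra.IsAlgebraic A C :=
    ⟨fun c => (isAlgebraic_algebraMap_iff (A := Ω) Subtype.val_injective).1 c.2⟩
  let f : R →+* C := (algebraMap R Ω).codRestrict C h
  let := f.toAlgebra
  have : IsScalarTower R C Ω := IsScalarTower.of_algebraMap_eq fun _ => rfl
  have hf : Function.Injective (algebraMap R C) := fun a b hab =>
    FaithfulSMul.algebraMap_injective R Ω (congrArg Subtype.val hab)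
  exact ⟨fun z => ((Algebra.IsAlgebraic.isAlgebraic (R := R) z).extendScalars hf).restrictScalars A⟩

/-- Injectivity of `f` is not assumed: it holds on `ℤ[u]` because `f u` is transcendental, and
everything is algebraic over `ℤ[u]`. -/
theorem exists_endomorphism_extending {R S Ω : Type*} [CommRing R] [IsDomain R] [CommRing S]
    [IsDomain S] [Field Ω] [CharZero Ω] [IsAlgClosed Ω] [Algebra R Ω] [FaithfulSMul R Ω]
    [Algebra.IsAlgebraic R Ω] [Algebra S Ω] [FaithfulSMul S Ω] {x y : Ω}
    (hx : Transcendental ℤ x) (hx0 : x ≠ 0) (hy0 : y ≠ 0)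
    (hdep : ¬ LinearIndependent ℤ (fun p : ℤ × ℤ => x ^ p.1 * y ^ p.2))
    (hR : ∀ C : Subring Ω, x ∈ C → x⁻¹ ∈ C → y ∈ C → y⁻¹ ∈ C → ∀ r : R, algebraMap R Ω r ∈ C)
    {n : ℕ} (hn : 0 < n) {u : S} (hu : algebraMap S Ω u = x ^ n) (f : S →+* Ω)
    (hf : Transcendental ℤ (f u)) : ∃ g : Ω →+* Ω, ∀ s, g (algebraMap S Ω s) = f s := by
  let : Algebra (Polynomial ℤ) S := (Polynomial.aeval u).toRingHom.toAlgebra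
  let : Algebra (Polynomial ℤ) Ω :=
    ((algebraMap S Ω).comp (Polynomial.aeval u).toRingHom).toAlgebra
  have : IsScalarTower (Polynomial ℤ) S Ω := IsScalarTower.of_algebraMap_eq fun _ => rfl
  obtain ⟨hxalg, hyalg⟩ := isAlgebraic_of_algebraMap_X_eq_pow hx hx0 hy0 hdep hn (by
    rw [← hu]
    exact congrArg (algebraMap S Ω) (Polynomial.aeval_X u))
  have : Algebra.IsAlgebraic (Polynomial ℤ) Ω := Algebra.isAlgebraic_of_generated (R := R)
    (hR (Subalgebra.algebraicClosure (Polynomial ℤ) Ω).toSubring hxalg hxalg.inv hyalg hyalg.inv)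
  refine IsAlgClosed.exists_ringHom_extension (A := Polynomial ℤ) f ?_
  have e : f.comp (algebraMap (Polynomial ℤ) S) = (Polynomial.aeval (R := ℤ) (f u)).toRingHom := by
    refine Polynomial.ringHom_ext' (RingHom.ext_int _ _) ?_
    change f (Polynomial.aeval u Polynomial.X) = Polynomial.aeval (f u) Polynomial.X
    simp
  rw [e]
  exact transcendental_iff_injective.1 hf

/-! ### The group ring and its quotient -/

/-- A surjective endomorphism of `ℤ²` is injective, so two generators form a basis. -/
theorem zpow_mul_zpow_bijective {Q : Type*} [CommGroup Q] {x y : Q} (hgen : twoGen x y = ⊤)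
    (hQ : Nonempty (Q ≃* Multiplicative (ℤ × ℤ))) :
    Function.Bijective (fun p : ℤ × ℤ => x ^ p.1 * y ^ p.2) := by
  have hsurj : Function.Surjective (fun p : ℤ × ℤ => x ^ p.1 * y ^ p.2) := by
    intro q
    have hq : q ∈ twoGen x y := hgen ▸ Subgroup.mem_top q
    obtain ⟨i, j, h⟩ := Subgroup.mem_closure_pair.1 hq
    exact ⟨(i, j), h⟩
  refine ⟨?_, hsurj⟩
  obtain ⟨e⟩ := hQ
  let f : ℤ × ℤ →+ ℤ × ℤ :=
    { toFun := fun p => (e (x ^ p.1 * y ^ p.2)).toAdd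
      map_zero' := by simp
      map_add' := fun p q => by
        rw [← toAdd_mul, ← map_mul]
        congr 2
        simp only [Prod.fst_add, Prod.snd_add, zpow_add]
        exact mul_mul_mul_comm _ _ _ _ }
  have hf : Function.Injective f.toIntLinearMap := by
    apply OrzechProperty.injective_of_surjective_endomorphism
    intro w
    obtain ⟨p, hp⟩ := hsurj (e.symm (Multiplicative.ofAdd w))
    refine ⟨p, ?_⟩
    change (e (x ^ p.1 * y ^ p.2)).toAdd = w
    have hp' : x ^ p.1 * y ^ p.2 = e.symm (Multiplicative.ofAdd w) := hp
    rw [hp', e.apply_symm_apply, toAdd_ofAdd]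
  intro p q h
  exact hf (congrArg (fun z => (e z).toAdd) h)

/-- The surjections `ℤQ → ℤ[ℤ] → ℤ` each kill a nonzerodivisor, a group element minus 1, so each
lowers the dimension by at least one. -/
theorem three_le_ringKrullDim_monoidAlgebra {Q : Type*} [CommGroup Q]
    (e : Q ≃* Multiplicative (ℤ × ℤ)) [IsDomain (MonoidAlgebra ℤ Q)] :
    3 ≤ ringKrullDim (MonoidAlgebra ℤ Q) := by
  let π : Q →* Multiplicative ℤ := (AddMonoidHom.toMultiplicative (AddMonoidHom.fst ℤ ℤ)).comp e
  have hπ : Function.Surjective π := fun w => ⟨e.symm (Multiplicative.ofAdd (w.toAdd, 0)), by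
    simp [π]⟩
  let q : Q := e.symm (Multiplicative.ofAdd (0, 1))
  have hq : q ≠ 1 := by simp [q]
  have hπq : π q = 1 := by simp [π, q]
  have h1 : ringKrullDim (MonoidAlgebra ℤ (Multiplicative ℤ)) + 1 ≤
      ringKrullDim (MonoidAlgebra ℤ Q) := by
    refine ringKrullDim_succ_le_of_surjective (MonoidAlgebra.mapDomainRingHom ℤ π) ?_
      (r := MonoidAlgebra.of ℤ Q q - 1) (mem_nonZeroDivisors_of_ne_zero ?_) ?_
    · intro a
      induction a using MonoidAlgebra.induction_on with
      | of w =>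
        obtain ⟨r, rfl⟩ := hπ w
        exact ⟨MonoidAlgebra.of ℤ Q r, by simp⟩
      | add a b ha hb =>
        obtain ⟨a', rfl⟩ := ha
        obtain ⟨b', rfl⟩ := hb
        exact ⟨a' + b', map_add _ _ _⟩
      | smul m a ha =>
        obtain ⟨a', rfl⟩ := ha
        exact ⟨m • a', map_zsmul _ _ _⟩
    · rw [sub_ne_zero, ← map_one (MonoidAlgebra.of ℤ Q)]
      exact MonoidAlgebra.of_injective.ne hq
    · rw [map_sub, map_one, sub_eq_zero]
      simp [hπq, MonoidAlgebra.one_def]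
  have h2 : ringKrullDim ℤ + 1 ≤ ringKrullDim (MonoidAlgebra ℤ (Multiplicative ℤ)) := by
    let w : Multiplicative ℤ := Multiplicative.ofAdd 1
    have hw : w ≠ 1 := by simp [w]
    refine ringKrullDim_succ_le_of_surjective
      (MonoidAlgebra.lift ℤ ℤ (Multiplicative ℤ) 1).toRingHom ?_
      (r := MonoidAlgebra.of ℤ _ w - 1) (mem_nonZeroDivisors_of_ne_zero ?_) ?_
    · intro m
      exact ⟨algebraMap ℤ _ m, by simp⟩
    · rw [sub_ne_zero, ← map_one (MonoidAlgebra.of ℤ _)]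
      exact MonoidAlgebra.of_injective.ne hw
    · simp
  have h3 : ringKrullDim ℤ = 1 := IsPrincipalIdealRing.ringKrullDim_eq_one ℤ Int.not_isField
  rw [h3] at h2
  calc (3 : WithBot ℕ∞) = 1 + 1 + 1 := by norm_num
    _ ≤ ringKrullDim (MonoidAlgebra ℤ (Multiplicative ℤ)) + 1 := by gcongr
    _ ≤ _ := h1

theorem ideal_ne_bot_of_ringKrullDim_eq_two {Q : Type*} [CommGroup Q]
    (e : Q ≃* Multiplicative (ℤ × ℤ)) (J : Ideal (MonoidAlgebra ℤ Q))
    [IsDomain (MonoidAlgebra ℤ Q ⧸ J)] (hdim : ringKrullDim (MonoidAlgebra ℤ Q ⧸ J) = 2) :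
    J ≠ ⊥ := by
  rintro rfl
  let E := RingEquiv.quotientBot (MonoidAlgebra ℤ Q)
  have : IsDomain (MonoidAlgebra ℤ Q) := E.symm.toMulEquiv.isDomain _
  have h := three_le_ringKrullDim_monoidAlgebra e
  rw [← ringKrullDim_eq_of_ringEquiv E, hdim] at h
  exact absurd h (by decide)

theorem linearCombination_groupToQuot {Q : Type*} [CommGroup Q] (J : Ideal (MonoidAlgebra ℤ Q))
    (a : MonoidAlgebra ℤ Q) :
    Finsupp.linearCombination ℤ (groupToQuot J) a.coeff = Ideal.Quotient.mk J a := by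
  have h : MonoidAlgebra.lift ℤ (MonoidAlgebra ℤ Q ⧸ J) Q (groupToQuot J) =
      Ideal.Quotient.mkₐ ℤ J := by
    refine MonoidAlgebra.algHom_ext (fun q => ?_) (Subsingleton.elim _ _)
    rw [MonoidAlgebra.lift_single, one_smul]
    rfl
  have h' := DFunLike.congr_fun h a
  rwa [MonoidAlgebra.lift_apply] at h'

theorem not_linearIndependent_groupToQuot {Q : Type*} [CommGroup Q]
    {J : Ideal (MonoidAlgebra ℤ Q)} (hJ : J ≠ ⊥) : ¬ LinearIndependent ℤ (groupToQuot J) := by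
  intro h
  obtain ⟨a, ha, ha0⟩ := Submodule.exists_mem_ne_zero_of_ne_bot hJ
  refine ha0 (MonoidAlgebra.coeff_eq_zero.1 (linearIndependent_iff.1 h _ ?_))
  rw [linearCombination_groupToQuot]
  exact Ideal.Quotient.eq_zero_iff_mem.2 ha

theorem algebraMap_quot_mem_of_generators_mem {Q : Type*} [CommGroup Q]
    {J : Ideal (MonoidAlgebra ℤ Q)} {x y : Q} (hgen : twoGen x y = ⊤) {Ω : Type*} [Field Ω]
    (f : MonoidAlgebra ℤ Q ⧸ J →+* Ω) (C : Subring Ω) (hx : f (groupToQuot J x) ∈ C)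
    (hx' : (f (groupToQuot J x))⁻¹ ∈ C) (hy : f (groupToQuot J y) ∈ C)
    (hy' : (f (groupToQuot J y))⁻¹ ∈ C) (r : MonoidAlgebra ℤ Q ⧸ J) : f r ∈ C := by
  have hinv : ∀ q : Q, f (groupToQuot J q⁻¹) = (f (groupToQuot J q))⁻¹ := fun q => by
    refine eq_inv_of_mul_eq_one_left ?_
    rw [← map_mul, ← map_mul, inv_mul_cancel, map_one, map_one]
  have hQ : ∀ q : Q, f (groupToQuot J q) ∈ C ∧ f (groupToQuot J q⁻¹) ∈ C := by
    intro q
    have hq : q ∈ twoGen x y := hgen ▸ Subgroup.mem_top q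
    refine Subgroup.closure_induction
      (p := fun q _ => f (groupToQuot J q) ∈ C ∧ f (groupToQuot J q⁻¹) ∈ C) ?_ ?_ ?_ ?_ hq
    · rintro z (rfl | rfl)
      · exact ⟨hx, by rwa [hinv]⟩
      · exact ⟨hy, by rwa [hinv]⟩
    · simp
    · intro a b _ _ ha hb
      rw [mul_inv, map_mul, map_mul, map_mul, map_mul]
      exact ⟨mul_mem ha.1 hb.1, mul_mem ha.2 hb.2⟩
    · intro a _ ha
      rw [inv_inv]
      exact ha.symm
  obtain ⟨a, rfl⟩ := Ideal.Quotient.mk_surjective r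
  rw [← linearCombination_groupToQuot, Finsupp.linearCombination_apply, Finsupp.sum, map_sum]
  refine sum_mem fun q _ => ?_
  rw [map_zsmul]
  exact zsmul_mem (hQ q).1 _

/-! ### Assembly inside an algebraic closure -/

theorem eq_exponents_of_subringGenBy_hom {Q : Type*} [CommGroup Q] (x y : Q)
    (hgen : twoGen x y = ⊤) (hQ : Nonempty (Q ≃* Multiplicative (ℤ × ℤ)))
    (J : Ideal (MonoidAlgebra ℤ Q))
    [IsDomain (MonoidAlgebra ℤ Q ⧸ J)] {Ω : Type*} [Field Ω] [IsAlgClosed Ω] [CharZero Ω]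
    [Algebra (MonoidAlgebra ℤ Q ⧸ J) Ω] [FaithfulSMul (MonoidAlgebra ℤ Q ⧸ J) Ω]
    [Algebra.IsAlgebraic (MonoidAlgebra ℤ Q ⧸ J) Ω]
    (hdim : ringKrullDim (MonoidAlgebra ℤ Q ⧸ J) = 2)
    (hmtr : ∀ q : Q, q ≠ 1 →
      Transcendental ℚ (algebraMap (MonoidAlgebra ℤ Q ⧸ J) Ω (groupToQuot J q)))
    (n c₁ c₂ : ℕ) (hn : 0 < n) (hc₁ : 0 < c₁) (hc₂ : 0 < c₂)
    (φ : subringGenBy J (twoGen (x ^ n) (y ^ n)) →+*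
      subringGenBy J (twoGen (x ^ c₁) (y ^ c₂)))
    (hφx : φ (subgroupToSubring J _ (twoGen.fst (x ^ n) (y ^ n))) =
      subgroupToSubring J _ (twoGen.fst (x ^ c₁) (y ^ c₂)))
    (hφy : φ (subgroupToSubring J _ (twoGen.snd (x ^ n) (y ^ n))) =
      subgroupToSubring J _ (twoGen.snd (x ^ c₁) (y ^ c₂))) :
    n = c₁ ∧ n = c₂ := by
  let R := MonoidAlgebra ℤ Q ⧸ J
  have hRΩ : Function.Injective (algebraMap R Ω) := FaithfulSMul.algebraMap_injective R Ω
  let m : Q →* Ω := (algebraMap R Ω : R →* Ω).comp (groupToQuot J)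
  have hm0 : ∀ q, m q ≠ 0 := fun q h0 => by
    have : m (q * q⁻¹) = 0 := by rw [map_mul, h0, zero_mul]
    simp at this
  have hbij := zpow_mul_zpow_bijective hgen hQ
  have hmzpow : ∀ (q : Q) (i : ℤ), m (q ^ i) = m q ^ i := fun q i => by
    have hu : ∀ r : Q, m r = ((Units.map m (toUnits r) : Ωˣ) : Ω) := fun r => rfl
    rw [hu, hu, map_zpow, map_zpow, Units.val_zpow_eq_zpow_val]
  have hmon : ∀ p : ℤ × ℤ, m x ^ p.1 * m y ^ p.2 = m (x ^ p.1 * y ^ p.2) := fun p => by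
    rw [map_mul, hmzpow, hmzpow]
  have htr : ∀ i j : ℤ, (i, j) ≠ (0, 0) → Transcendental ℚ (m x ^ i * m y ^ j) := by
    intro i j hij
    rw [hmon (i, j)]
    refine hmtr _ fun h => hij (hbij.1 ?_)
    simpa using h
  have hdep : ¬ LinearIndependent ℤ (fun p : ℤ × ℤ => m x ^ p.1 * m y ^ p.2) := by
    intro h
    obtain ⟨e⟩ := hQ
    refine not_linearIndependent_groupToQuot (ideal_ne_bot_of_ringKrullDim_eq_two e J hdim) ?_
    refine LinearIndependent.of_comp (algebraMap R Ω).toAddMonoidHom.toIntLinearMap ?_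
    refine (linearIndependent_equiv (Equiv.ofBijective _ hbij)).1 ?_
    simp only [hmon] at h
    exact h
  have hne : ∀ {z : Q} {c : ℕ}, 0 < c → z ≠ 1 → z ^ c ≠ 1 := fun {z c} hc hz h => by
    obtain ⟨e⟩ := hQ
    have h1 : (c : ℤ) • (e z).toAdd = 0 := by
      have := congrArg (fun w => (e w).toAdd) h
      simpa using this
    refine hz (e.map_eq_one_iff.1 ?_)
    exact (smul_eq_zero.1 h1).resolve_left (by exact_mod_cast hc.ne')
  have hx1 : x ≠ 1 := fun h => by
    have := @hbij.1 (1, 0) (0, 0) (by simp [h])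
    simp at this
  have hint : ∀ z : Ω, Transcendental ℚ z → Transcendental ℤ z := fun z hz h =>
    hz (h.extendScalars Int.cast_injective)
  let S := subringGenBy J (twoGen (x ^ n) (y ^ n))
  have : FaithfulSMul S Ω := (faithfulSMul_iff_algebraMap_injective S Ω).2
    (hRΩ.comp Subtype.val_injective)
  let f : S →+* Ω := (algebraMap R Ω).comp ((Subring.subtype _).comp φ)
  have hfx : f (subgroupToSubring J _ (twoGen.fst (x ^ n) (y ^ n))) = m x ^ c₁ := by
    rw [← map_pow]
    exact congrArg (fun s => algebraMap R Ω s.1) hφx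
  have hfy : f (subgroupToSubring J _ (twoGen.snd (x ^ n) (y ^ n))) = m y ^ c₂ := by
    rw [← map_pow]
    exact congrArg (fun s => algebraMap R Ω s.1) hφy
  have hSx : algebraMap S Ω (subgroupToSubring J _ (twoGen.fst (x ^ n) (y ^ n))) = m x ^ n := by
    rw [← map_pow]
    rfl
  have hSy : algebraMap S Ω (subgroupToSubring J _ (twoGen.snd (x ^ n) (y ^ n))) = m y ^ n := by
    rw [← map_pow]
    rfl
  obtain ⟨σ, hσ⟩ := exists_endomorphism_extending (R := R) (hint _ (hmtr x hx1)) (hm0 x) (hm0 y)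
    hdep (fun C h1 h2 h3 h4 r => algebraMap_quot_mem_of_generators_mem hgen _ C h1 h2 h3 h4 r)
    hn hSx f (by
      rw [hfx, ← map_pow]
      exact hint _ (hmtr _ (hne hc₁ hx1)))
  have hσx : σ (m x ^ n) = m x ^ c₁ := by rw [← hSx, hσ, hfx]
  have hσy : σ (m y ^ n) = m y ^ c₂ := by rw [← hSy, hσ, hfy]
  -- The same `σ` serves twice, the second time with `x` and `y` exchanged.
  refine ⟨eq_exponent_of_endomorphism (hm0 x) (hm0 y) htr hdep hn hc₁ hc₂ σ hσx hσy,
    eq_exponent_of_endomorphism (hm0 y) (hm0 x) (fun i j hij => ?_) (fun h => hdep ?_)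
      hn hc₂ hc₁ σ hσy hσx⟩
  · rw [mul_comm]
    exact htr j i fun h => hij (by rw [Prod.mk.injEq] at h ⊢; exact h.symm)
  · refine (linearIndependent_equiv (Equiv.prodComm ℤ ℤ)).1 ?_
    convert h using 1
    ext p
    exact mul_comm _ _

theorem propositions2 {Q : Type*} [CommGroup Q] (x y : Q)
    (hgen : twoGen x y = ⊤) (hQ : Nonempty (Q ≃* Multiplicative (ℤ × ℤ)))
    (J : Ideal (MonoidAlgebra ℤ Q))
    [IsDomain (MonoidAlgebra ℤ Q ⧸ J)] [CharZero (MonoidAlgebra ℤ Q ⧸ J)]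
    (hdim : ringKrullDim (MonoidAlgebra ℤ Q ⧸ J) = 2)
    (halg : ∀ q : Q, q ≠ 1 →
      ¬ IsAlgebraic ℚ (algebraMap (MonoidAlgebra ℤ Q ⧸ J)
        (FractionRing (MonoidAlgebra ℤ Q ⧸ J)) (groupToQuot J q)))
    (n c₁ c₂ : ℕ) (hn : 0 < n) (hc₁ : 0 < c₁) (hc₂ : 0 < c₂)
    (φ : subringGenBy J (twoGen (x ^ n) (y ^ n)) →+*
      subringGenBy J (twoGen (x ^ c₁) (y ^ c₂)))
    (hφx : φ (subgroupToSubring J _ (twoGen.fst (x ^ n) (y ^ n))) =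
      subgroupToSubring J _ (twoGen.fst (x ^ c₁) (y ^ c₂)))
    (hφy : φ (subgroupToSubring J _ (twoGen.snd (x ^ n) (y ^ n))) =
      subgroupToSubring J _ (twoGen.snd (x ^ c₁) (y ^ c₂))) :
    n = c₁ ∧ n = c₂ := by
  have hRK : Function.Injective (algebraMap (MonoidAlgebra ℤ Q ⧸ J)
      (FractionRing (MonoidAlgebra ℤ Q ⧸ J))) := IsFractionRing.injective _ _
  have hKΩ := (algebraMap (FractionRing (MonoidAlgebra ℤ Q ⧸ J))
    (AlgebraicClosure (FractionRing (MonoidAlgebra ℤ Q ⧸ J)))).injective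
  have hcomp := IsScalarTower.algebraMap_eq (MonoidAlgebra ℤ Q ⧸ J)
    (FractionRing (MonoidAlgebra ℤ Q ⧸ J)) (AlgebraicClosure (FractionRing (MonoidAlgebra ℤ Q ⧸ J)))
  have : FaithfulSMul (MonoidAlgebra ℤ Q ⧸ J)
      (AlgebraicClosure (FractionRing (MonoidAlgebra ℤ Q ⧸ J))) := by
    refine (faithfulSMul_iff_algebraMap_injective (MonoidAlgebra ℤ Q ⧸ J)
      (AlgebraicClosure (FractionRing (MonoidAlgebra ℤ Q ⧸ J)))).2 ?_
    rw [hcomp]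
    exact hKΩ.comp hRK
  have : Algebra.IsAlgebraic (MonoidAlgebra ℤ Q ⧸ J) (FractionRing (MonoidAlgebra ℤ Q ⧸ J)) :=
    IsLocalization.isAlgebraic _ (nonZeroDivisors _)
  have : Algebra.IsAlgebraic (MonoidAlgebra ℤ Q ⧸ J)
      (AlgebraicClosure (FractionRing (MonoidAlgebra ℤ Q ⧸ J))) :=
    Algebra.IsAlgebraic.trans _ (FractionRing (MonoidAlgebra ℤ Q ⧸ J)) _
  refine eq_exponents_of_subringGenBy_hom
    (Ω := AlgebraicClosure (FractionRing (MonoidAlgebra ℤ Q ⧸ J))) x y hgen hQ J hdim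
    (fun q hq h => halg q hq ?_) n c₁ c₂ hn hc₁ hc₂ φ hφx hφy
  rw [hcomp] at h
  exact (isAlgebraic_algHom_iff (algebraMap (FractionRing (MonoidAlgebra ℤ Q ⧸ J))
    (AlgebraicClosure (FractionRing (MonoidAlgebra ℤ Q ⧸ J)))).toRatAlgHom hKΩ).1 h
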